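/- Let $q \le 3$ be a prime power (so $q \in \{2,3\}$), $A = \mathbb{F}_q[t]$ and $\Gamma = SL_2(A)$. For an ideal $I$ of $A$ put $\Gamma(I) = \{M \in \Gamma : M \equiv I_2 \pmod{I}\}$. A subgroup of $\Gamma$ is called a congruence subgroup if it contains $\Gamma(I)$ for some ideal $I \neq \{0\}$ of $A$, and a non-congruence subgroup if it has finite index in $\Gamma$ and is not a congruence subgroup. A finite index subgroup $S$ of $\Gamma$ is called a genuine non-congruence subgroup if $\Psi(S)$ is a non-congruence subgroup for every $\Psi \in \mathrm{Aut}(\Gamma)$. Let $N$ be a normal genuine non-congruence subgroup of $\Gamma$. Then $q^2$ divides $|\Gamma : N|$. Moreover, $\Gamma$ has normal non-congruence subgroups and normal genuine non-congruence subgroups, and if $\mathrm{nncs}(\Gamma)$ denotes the smallest index in $\Gamma$ of a normal non-congruence subgroup and $\mathrm{ngncs}(\Gamma)$ the smallest index in $\Gamma$ of a normal genuine non-congruence subgroup, then $$\mathrm{ngncs}(\Gamma) > \mathrm{nncs}(\Gamma) = q.$$ -/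

import Mathlib

open scoped Polynomial

namespace SL2Congruence

/-- The group `SL₂(A)`. -/
abbrev SL2 (A : Type*) [CommRing A] : Type _ := Matrix.SpecialLinearGroup (Fin 2) A

/-- The principal congruence subgroup `Γ(I) = {M ∈ SL₂(A) : M ≡ 1 mod I}` of an ideal `I`,
i.e. the kernel of the entrywise reduction `SL₂(A) → SL₂(A/I)`. -/
def principal {A : Type*} [CommRing A] (I : Ideal A) : Subgroup (SL2 A) :=
  (Matrix.SpecialLinearGroup.map (n := Fin 2) (Ideal.Quotient.mk I)).ker

/-- Membership in `Γ(I)`, entry by entry. -/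
theorem mem_principal {A : Type*} [CommRing A] (I : Ideal A) (M : SL2 A) :
    M ∈ principal I ↔
      ∀ i j : Fin 2, M.1 i j - (1 : Matrix (Fin 2) (Fin 2) A) i j ∈ I := by
  rw [principal, MonoidHom.mem_ker, Matrix.SpecialLinearGroup.ext_iff]
  refine forall_congr' fun i => forall_congr' fun j => ?_
  rw [← Ideal.Quotient.eq]
  have h1 : Ideal.Quotient.mk I ((1 : Matrix (Fin 2) (Fin 2) A) i j)
      = (1 : Matrix (Fin 2) (Fin 2) (A ⧸ I)) i j := by
    rw [Matrix.one_apply, Matrix.one_apply]; split_ifs <;> simp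
  rw [h1]
  rfl

/-- A congruence subgroup of `SL₂(A)` contains `Γ(I)` for some non-zero ideal `I`. -/
def IsCongruence {A : Type*} [CommRing A] (S : Subgroup (SL2 A)) : Prop :=
  ∃ I : Ideal A, I ≠ ⊥ ∧ principal I ≤ S

/-- A non-congruence subgroup is a finite index subgroup that is not a congruence subgroup. -/
def IsNonCongruence {A : Type*} [CommRing A] (S : Subgroup (SL2 A)) : Prop :=
  S.FiniteIndex ∧ ¬ IsCongruence S

/-- A non-congruence subgroup `S` of `SL₂(A)` is genuine if `Ψ(S)` is a non-congruence subgroup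
for every automorphism `Ψ` of the abstract group `SL₂(A)`. -/
def IsGenuineNonCongruence {A : Type*} [CommRing A] (S : Subgroup (SL2 A)) : Prop :=
  S.FiniteIndex ∧ ∀ Ψ : SL2 A ≃* SL2 A, IsNonCongruence (S.map Ψ.toMonoidHom)

/-- The set of indices of the normal non-congruence subgroups of `SL₂(A)`. -/
def normalNonCongruenceIndices (A : Type*) [CommRing A] : Set ℕ :=
  {n | ∃ N : Subgroup (SL2 A), N.Normal ∧ IsNonCongruence N ∧ N.index = n}

/-- The set of indices of the normal genuine non-congruence subgroups of `SL₂(A)`. -/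
def normalGenuineNonCongruenceIndices (A : Type*) [CommRing A] : Set ℕ :=
  {n | ∃ N : Subgroup (SL2 A), N.Normal ∧ IsGenuineNonCongruence N ∧ N.index = n}

/-- `nncs(SL₂(A))`: the smallest index of a normal non-congruence subgroup
(with the value `0`, never an index here, if there is none). -/
noncomputable def nncs (A : Type*) [CommRing A] : ℕ :=
  sInf (normalNonCongruenceIndices A)

/-- `ngncs(SL₂(A))`: the smallest index of a normal genuine non-congruence subgroup
(with the value `0`, never an index here, if there is none). -/
noncomputable def ngncs (A : Type*) [CommRing A] : ℕ :=
  sInf (normalGenuineNonCongruenceIndices A)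

end SL2Congruence

/-!
Let `F` be the field with `q ≤ 3` elements, `A = F[X]` and `Γ = SL₂(A)`.

The Euclidean algorithm shows that `Γ` is the amalgam of `SL₂(F)` and the group of upper triangular
matrices over `A`. The form used here is the universal property `lift`: homomorphisms on `SL₂(F)` and
on the unipotent matrices `upper x` extend to `Γ` as soon as they are compatible. Since `q ≤ 3`, the
units of `F` have square `1`, so compatibility with the torus costs nothing, and `SL₂(F)` has a
character with `upper x ↦ x`. Consequently there is a homomorphism `Γ → A` with `upper x ↦ x`
(`exists_hom_polynomial`), and each additive automorphism of `A` that fixes `F` pointwise extends to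
an automorphism of `Γ` (`exists_mulEquiv_of_addEquiv`).

Let `N` be normal of finite index and `H = {x | upper x ∈ N}`. As `q` is prime, `H` is a subspace of
`A`, and the order of `A / H` divides the index of `N`. If `H = A` then `N = Γ`. If `H` is a
hyperplane, a transvection of `A` fixing `F` moves it to a standard hyperplane for which the image
of `N` visibly contains `Γ(X)` or `Γ(X (X - 1))`, so `N` is not genuine (`sq_dvd_index`). Hence a
genuine `N` has `H` of codimension at least two, which gives the divisibility by `q²`.

For existence, a congruence subgroup with abelian quotient contains `upper y` for every multiple `y`
of the quartic `(X² - 1) (X² + 2 X)` (`upper_mem_of_isCongruence`), because the subgroup is normalized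
by lifts of `diag(v, v⁻¹)` for all `v` prime to the level. So its index is at most `q⁴`
(`index_le_of_isCongruence`). The preimage in `Γ` of the kernel of the fourth coefficient is therefore
non-congruence of index `q`, and the preimage of the polynomials divisible by `X⁵` is a genuine
non-congruence subgroup of index `q⁵`: the bound depends only on the isomorphism type of the
quotient.
-/

namespace SL2Congruence

open Polynomial Matrix

open Multiplicative (ofAdd)

/-! ### Generators of `SL₂` -/

section Generators

variable {R : Type*} [CommRing R]

/-- The upper unipotent matrix `!![1, x; 0, 1]`. -/
def upper (x : R) : SL2 R := ⟨!![1, x; 0, 1], by simp [det_fin_two]⟩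

/-- The Weyl element `!![0, -1; 1, 0]`. -/
def weyl : SL2 R := ⟨!![0, -1; 1, 0], by simp [det_fin_two]⟩

/-- The diagonal matrix with entries `e` and `e⁻¹`. -/
def torus (e : Rˣ) : SL2 R := ⟨!![(e : R), 0; 0, (e⁻¹ : Rˣ)], by simp [det_fin_two]⟩

@[simp] theorem coe_upper (x : R) : (upper x : Matrix (Fin 2) (Fin 2) R) = !![1, x; 0, 1] := rfl

@[simp] theorem coe_weyl : ((weyl : SL2 R) : Matrix (Fin 2) (Fin 2) R) = !![0, -1; 1, 0] := rfl

@[simp] theorem coe_torus (e : Rˣ) :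
    (torus e : Matrix (Fin 2) (Fin 2) R) = !![(e : R), 0; 0, (e⁻¹ : Rˣ)] := rfl

theorem upper_add (x y : R) : upper (x + y) = upper x * upper y := by
  ext i j; fin_cases i <;> fin_cases j <;> simp [add_comm]

@[simp] theorem upper_zero : upper (0 : R) = 1 := by
  ext i j; fin_cases i <;> fin_cases j <;> simp

theorem upper_neg (x : R) : upper (-x) = (upper x)⁻¹ := by
  rw [eq_inv_iff_mul_eq_one, ← upper_add, neg_add_cancel, upper_zero]

/-- The upper unipotent matrices as a homomorphism from the additive group of `R`. -/
def upperHom : Multiplicative R →* SL2 R where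
  toFun x := upper x.toAdd
  map_one' := upper_zero
  map_mul' _ _ := upper_add _ _

@[simp] theorem upperHom_ofAdd (x : R) : upperHom (Multiplicative.ofAdd x) = upper x := rfl

@[simp] theorem map_upper {S : Type*} [CommRing S] (f : R →+* S) (x : R) :
    Matrix.SpecialLinearGroup.map f (upper x) = upper (f x) := by
  ext i j; fin_cases i <;> fin_cases j <;> simp

@[simp] theorem map_weyl {S : Type*} [CommRing S] (f : R →+* S) :
    Matrix.SpecialLinearGroup.map f (weyl : SL2 R) = weyl := by
  ext i j; fin_cases i <;> fin_cases j <;> simp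

@[simp] theorem map_torus {S : Type*} [CommRing S] (f : R →+* S) (e : Rˣ) :
    Matrix.SpecialLinearGroup.map f (torus e) = torus (Units.map f e) := by
  ext i j; fin_cases i <;> fin_cases j <;> simp

theorem torus_mul_weyl (e : Rˣ) : torus e * weyl = weyl * torus e⁻¹ := by
  ext i j; fin_cases i <;> fin_cases j <;> simp

theorem weyl_inv : (weyl : SL2 R)⁻¹ = torus (-1) * weyl := by
  rw [inv_eq_iff_mul_eq_one]
  ext i j; fin_cases i <;> fin_cases j <;> simp

theorem torus_mul_upper (e : Rˣ) (x : R) : torus e * upper x = upper (e ^ 2 * x) * torus e := by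
  ext i j; fin_cases i <;> fin_cases j <;> simp
  linear_combination (-(e : R) * x) * e.mul_inv

theorem upper_mul_apply (x : R) (M : SL2 R) :
    (upper x * M) 0 0 = M 0 0 + x * M 1 0 ∧ (upper x * M) 0 1 = M 0 1 + x * M 1 1 ∧
    (upper x * M) 1 0 = M 1 0 ∧ (upper x * M) 1 1 = M 1 1 := by
  simp [Matrix.mul_apply, Fin.sum_univ_two]

theorem weyl_mul_apply (M : SL2 R) :
    (weyl * M : SL2 R) 0 0 = - M 1 0 ∧ (weyl * M : SL2 R) 1 0 = M 0 0 := by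
  simp [Matrix.mul_apply, Fin.sum_univ_two]

theorem weyl_inv_mul_apply (M : SL2 R) :
    (weyl⁻¹ * M : SL2 R) 0 0 = M 1 0 ∧ (weyl⁻¹ * M : SL2 R) 1 0 = - M 0 0 := by
  simp [Matrix.mul_apply, Fin.sum_univ_two]

theorem torus_mul_apply (e : Rˣ) (M : SL2 R) :
    (torus e * M) 0 0 = e * M 0 0 ∧ (torus e * M) 0 1 = e * M 0 1 ∧
    (torus e * M) 1 0 = (e⁻¹ : Rˣ) * M 1 0 ∧ (torus e * M) 1 1 = (e⁻¹ : Rˣ) * M 1 1 := by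
  simp [Matrix.mul_apply, Fin.sum_univ_two]

/-- The relation of `SL₂` that moves a constant quotient of the Euclidean algorithm past the Weyl
element. -/
theorem weyl_mul_upper_mul_weyl (e : Rˣ) :
    weyl * upper (e : R) * weyl =
      upper (-(e⁻¹ : Rˣ) : R) * weyl * torus e * upper (-(e⁻¹ : Rˣ) : R) := by
  ext i j; fin_cases i <;> fin_cases j <;> simp

/-- The Weyl element is a product of conjugates of unipotent matrices. -/
theorem weyl_eq : (weyl : SL2 R) = upper (-1) * (weyl * upper (-1) * weyl⁻¹) * upper (-1) := by
  ext i j; fin_cases i <;> fin_cases j <;> simp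

theorem torus_eq (e : Rˣ) : torus e =
    upper (e : R) * (weyl * upper ((e⁻¹ : Rˣ) : R) * weyl⁻¹) * upper (e : R) * weyl := by
  ext i j; fin_cases i <;> fin_cases j <;> simp

end Generators

/-! ### The Euclidean algorithm in `SL₂(F[X])` -/

section Field

variable {F : Type*} [Field F]

/-- Bruhat decomposition of `SL₂` of a field. -/
theorem bruhat (M : SL2 F) :
    (∃ (e : Fˣ) (x : F), M = upper x * torus e) ∨
      ∃ (e : Fˣ) (x y : F), M = upper x * weyl * torus e * upper y := by
  have hd := M.det_coe
  rw [det_fin_two] at hd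
  by_cases hc : M 1 0 = 0
  · left
    rw [hc, mul_zero, sub_zero] at hd
    refine ⟨Units.mkOfMulEqOne _ _ hd, M 0 1 * M 0 0, ?_⟩
    ext i j; fin_cases i <;> fin_cases j <;>
      simp [hc, mul_assoc]
    · rw [mul_inv_cancel₀ (left_ne_zero_of_mul_eq_one hd), mul_one]
    · exact eq_inv_of_mul_eq_one_right hd
  · right
    refine ⟨Units.mk0 _ hc, M 0 0 / M 1 0, M 1 1 / M 1 0, ?_⟩
    ext i j; fin_cases i <;> fin_cases j <;>
      simp <;> field_simp
    linear_combination -hd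

theorem eq_C_of_lower_eq_zero {M : SL2 F[X]} (h : M 1 0 = 0) :
    ∃ a d : F, M 0 0 = C a ∧ M 1 1 = C d ∧ a * d = 1 := by
  have hd := M.det_coe
  rw [det_fin_two, h, mul_zero, sub_zero] at hd
  obtain ⟨a, -, ha⟩ := Polynomial.isUnit_iff.1 (IsUnit.of_mul_eq_one _ hd)
  obtain ⟨d, -, hd'⟩ := Polynomial.isUnit_iff.1 (IsUnit.of_mul_eq_one_right _ hd)
  rw [← ha, ← hd', ← C_mul, ← C_1] at hd
  exact ⟨a, d, ha.symm, hd'.symm, C_injective hd⟩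

/-- A matrix that is upper triangular over `F[X]` is the product of a unipotent matrix and a constant
matrix, its value at `0`. -/
theorem eq_upper_mul_map (M : SL2 F[X]) (h : M 1 0 = 0) :
    M = upper (M 0 0 * (M 0 1 - C ((M 0 1).eval 0))) *
      SpecialLinearGroup.map C (SpecialLinearGroup.map (evalRingHom 0) M) := by
  obtain ⟨a, d, ha, hd, had⟩ := eq_C_of_lower_eq_zero h
  have had' : C a * C d = (1 : F[X]) := by rw [← C_mul, had, C_1]
  apply Subtype.ext
  apply Matrix.ext
  intro i j
  fin_cases i <;> fin_cases j <;>
    simp [Matrix.mul_apply, Fin.sum_univ_two, h, ha, hd]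
  linear_combination (C (eval 0 (M 0 1)) - M 0 1) * had'

/-- The result of one step of the Euclidean algorithm on the first column of `M`. -/
noncomputable def euclidStep (M : SL2 F[X]) : SL2 F[X] :=
  weyl⁻¹ * (upper (-(M 0 0 / M 1 0)) * M)

theorem upper_mul_weyl_mul_euclidStep (M : SL2 F[X]) :
    upper (M 0 0 / M 1 0) * (weyl * euclidStep M) = M := by
  simp [euclidStep, upper_neg]

theorem euclidStep_apply (M : SL2 F[X]) :
    euclidStep M 0 0 = M 1 0 ∧ euclidStep M 1 0 = -(M 0 0 % M 1 0) := by
  have h := weyl_inv_mul_apply (upper (-(M 0 0 / M 1 0)) * M)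
  have h2 := upper_mul_apply (-(M 0 0 / M 1 0)) M
  refine ⟨h.1.trans h2.2.2.1, h.2.trans ?_⟩
  rw [h2.1, EuclideanDomain.mod_eq_sub_mul_div]; ring

theorem degree_euclidStep_lt (M : SL2 F[X]) (h : M 1 0 ≠ 0) :
    (euclidStep M 1 0).degree < (M 1 0).degree := by
  rw [(euclidStep_apply M).2, degree_neg]
  exact Polynomial.degree_mod_lt _ h

/-- Induction along the Euclidean algorithm. -/
theorem euclid_induction {P : SL2 F[X] → Prop} (h0 : ∀ M, M 1 0 = 0 → P M)
    (h1 : ∀ M, M 1 0 ≠ 0 → P (euclidStep M) → P M) (M : SL2 F[X]) : P M := by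
  by_cases h : M 1 0 = 0
  · exact h0 M h
  · exact h1 M h (euclid_induction h0 h1 (euclidStep M))
termination_by (M 1 0).degree
decreasing_by exact degree_euclidStep_lt M h

/-- `SL₂(F[X])` is generated by the unipotent matrices together with `SL₂(F)`. -/
theorem hom_ext {G : Type*} [Group G] {f g : SL2 F[X] →* G}
    (hu : ∀ x, f (upper x) = g (upper x))
    (hc : ∀ M : SL2 F, f (SpecialLinearGroup.map C M) = g (SpecialLinearGroup.map C M)) :
    f = g := by
  ext M
  induction M using euclid_induction with
  | h0 M h => rw [eq_upper_mul_map M h, map_mul, map_mul, hu, hc]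
  | h1 M h ih =>
    rw [← upper_mul_weyl_mul_euclidStep M]
    have := hc weyl
    rw [map_weyl] at this
    simp only [map_mul, hu, ih, this]

/-! ### The amalgam decomposition of `SL₂(F[X])` -/

section Lift

variable {G : Type*} [Group G] (s : SL2 F →* G) (u : Multiplicative F[X] →* G)

open scoped Classical in
/-- The function underlying `lift`, by recursion along the Euclidean algorithm. -/
noncomputable def liftFun (M : SL2 F[X]) : G :=
  if h : M 1 0 = 0 then
    u (ofAdd (M 0 0 * (M 0 1 - C ((M 0 1).eval 0)))) *
      s (SpecialLinearGroup.map (evalRingHom 0) M)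
  else u (ofAdd (M 0 0 / M 1 0)) * (s weyl * liftFun (euclidStep M))
termination_by (M 1 0).degree
decreasing_by exact degree_euclidStep_lt M h

theorem liftFun_of_eq {M : SL2 F[X]} (h : M 1 0 = 0) : liftFun s u M =
    u (ofAdd (M 0 0 * (M 0 1 - C ((M 0 1).eval 0)))) *
      s (SpecialLinearGroup.map (evalRingHom 0) M) := by
  rw [liftFun, dif_pos h]

theorem liftFun_of_ne {M : SL2 F[X]} (h : M 1 0 ≠ 0) : liftFun s u M =
    u (ofAdd (M 0 0 / M 1 0)) * (s weyl * liftFun s u (euclidStep M)) := by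
  rw [liftFun, dif_neg h]

variable {s u} (hu : ∀ x : F, u (ofAdd (C x)) = s (upper x))
  (ht : ∀ (e : Fˣ) (x : F[X]),
    s (torus e) * u (ofAdd x) = u (ofAdd (C (e : F) ^ 2 * x)) * s (torus e))

theorem liftFun_one : liftFun s u (1 : SL2 F[X]) = 1 := by
  rw [liftFun_of_eq _ _ (by simp)]; simp

include hu in
theorem liftFun_upper_mul (x : F[X]) (M : SL2 F[X]) :
    liftFun s u (upper x * M) = u (ofAdd x) * liftFun s u M := by
  obtain ⟨h00, h01, h10, h11⟩ := upper_mul_apply x M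
  by_cases h : M 1 0 = 0
  · rw [liftFun_of_eq _ _ (h10.trans h), liftFun_of_eq _ _ h,
      MonoidHom.map_mul (SpecialLinearGroup.map _), map_upper, s.map_mul, ← hu, h00, h01,
      ← mul_assoc, ← mul_assoc, ← u.map_mul, ← u.map_mul, ← ofAdd_add, ← ofAdd_add]
    obtain ⟨a, d, ha, hd, had⟩ := eq_C_of_lower_eq_zero h
    congr 3
    have had' : C a * C d = (1 : F[X]) := by rw [← C_mul, had, C_1]
    simp only [h, ha, hd, eval_add, eval_mul, eval_C, C_add, C_mul, coe_evalRingHom]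
    linear_combination (x - C (eval 0 x)) * had'
  · have h' : (upper x * M) 1 0 ≠ 0 := by rwa [h10]
    have hq : (M 0 0 + x * M 1 0) / M 1 0 = M 0 0 / M 1 0 + x := by
      have e1 := EuclideanDomain.div_add_mod (M 0 0 + x * M 1 0) (M 1 0)
      have e2 := EuclideanDomain.div_add_mod (M 0 0) (M 1 0)
      have e3 : (M 0 0 + x * M 1 0) % M 1 0 = M 0 0 % M 1 0 := by
        rw [Polynomial.add_mod, (EuclideanDomain.mod_eq_zero).2 (Dvd.intro_left x rfl), add_zero]
      rw [e3] at e1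
      exact mul_left_cancel₀ h (by linear_combination e1 - e2)
    have hst : euclidStep (upper x * M) = euclidStep M := by
      rw [euclidStep, euclidStep, h00, h10, hq, ← mul_assoc (upper _), ← upper_add]
      congr 3; ring_nf
    rw [liftFun_of_ne _ _ h', liftFun_of_ne _ _ h, hst, h00, h10, hq, add_comm, ofAdd_add,
      u.map_mul, mul_assoc]

/-- Here the first step of the Euclidean algorithm for `weyl * M` just removes `weyl`. -/
theorem liftFun_weyl_mul_of_degree_lt (M : SL2 F[X]) (h : (M 1 0).degree < (M 0 0).degree) :
    liftFun s u (weyl * M) = s weyl * liftFun s u M := by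
  obtain ⟨h00, h10⟩ := weyl_mul_apply M
  have h0 : M 0 0 ≠ 0 := fun h0 => by simp [h0] at h
  have hq : (weyl * M : SL2 F[X]) 0 0 / (weyl * M : SL2 F[X]) 1 0 = 0 := by
    rw [h00, h10, Polynomial.div_eq_zero_iff h0, degree_neg]; exact h
  have h1 : euclidStep (weyl * M) = M := by
    rw [euclidStep, hq]; simp
  rw [liftFun_of_ne _ _ (by rwa [h10]), h1, hq]; simp

include hu ht in
theorem liftFun_torus_mul (e : Fˣ) (M : SL2 F[X]) :
    liftFun s u (torus (Units.map C.toMonoidHom e) * M) = s (torus e) * liftFun s u M := by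
  induction M using euclid_induction generalizing e with
  | h0 M h =>
    obtain ⟨h00, h01, h10, h11⟩ := torus_mul_apply (Units.map C.toMonoidHom e) M
    have hm : SpecialLinearGroup.map (evalRingHom (0 : F)) (torus (Units.map C.toMonoidHom e))
        = torus e := by
      ext i j; fin_cases i <;> fin_cases j <;> simp
    rw [liftFun_of_eq _ _ (by rw [h10, h, mul_zero]), liftFun_of_eq _ _ h, ← mul_assoc, ht,
      MonoidHom.map_mul (SpecialLinearGroup.map _), hm, s.map_mul, h00, h01, mul_assoc (u _)]
    congr 3
    simp
    ring
  | h1 M h ih =>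
    have hdeg := degree_euclidStep_lt M h
    rw [← (euclidStep_apply M).1] at hdeg
    have h2 : (torus (Units.map C.toMonoidHom e)⁻¹ * euclidStep M) 1 0 =
      C ((e : F)) * (euclidStep M) 1 0 := by simp [torus_mul_apply]
    have h3 : (torus (Units.map C.toMonoidHom e)⁻¹ * euclidStep M) 0 0 =
      C ((e : F)⁻¹) * (euclidStep M) 0 0 := by simp [torus_mul_apply]
    have hw' := liftFun_weyl_mul_of_degree_lt (s := s) (u := u)
      (torus (Units.map C.toMonoidHom e)⁻¹ * euclidStep M) (by
        rw [h2, h3, degree_C_mul (by simp), degree_C_mul (by simp)]; exact hdeg)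
    conv_lhs => rw [← upper_mul_weyl_mul_euclidStep M]
    rw [← mul_assoc, torus_mul_upper, mul_assoc, liftFun_upper_mul hu, ← mul_assoc (torus _),
      torus_mul_weyl, mul_assoc weyl, hw', ← map_inv, ih, liftFun_of_ne _ _ h,
      ← mul_assoc (s (torus e)), ht, mul_assoc, ← mul_assoc (s (torus e)), ← s.map_mul, torus_mul_weyl, s.map_mul, mul_assoc]
    rfl

include hu ht in
/-- The case of equal degrees is the only one that uses a relation of `SL₂(F)`: the Euclidean
quotient is then a constant `e`, and `weyl * upper e * weyl` can be rewritten. -/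
theorem liftFun_weyl_mul (M : SL2 F[X]) : liftFun s u (weyl * M) = s weyl * liftFun s u M := by
  rcases lt_trichotomy (M 1 0).degree (M 0 0).degree with h | h | h
  · exact liftFun_weyl_mul_of_degree_lt M h
  · have hc : M 1 0 ≠ 0 := by
      intro hc
      have ha : M 0 0 = 0 := by rwa [hc, degree_zero, eq_comm, degree_eq_bot] at h
      have hd := M.det_coe
      rw [det_fin_two, ha, hc] at hd
      simp at hd
    have hq : (M 0 0 / M 1 0).degree = 0 := by
      have h1 := Polynomial.degree_add_div hc h.le
      have h2 : M 0 0 / M 1 0 ≠ 0 := fun h2 => by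
        rw [Polynomial.div_eq_zero_iff hc] at h2; exact absurd h h2.ne'
      rw [← h, degree_eq_natDegree hc, degree_eq_natDegree h2] at h1
      rw [degree_eq_natDegree h2]
      norm_cast at h1 ⊢
      omega
    have hq' := eq_C_of_degree_eq_zero hq
    set e0 := (M 0 0 / M 1 0).coeff 0
    have he0 : e0 ≠ 0 := by rintro h0; rw [hq', h0] at hq; simp at hq
    obtain ⟨e, he⟩ : ∃ e : Fˣ, (e : F) = e0 := ⟨Units.mk0 _ he0, rfl⟩
    rw [← he] at hq'
    set E := Units.map C.toMonoidHom e with hE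
    have hEc : M 0 0 / M 1 0 = (E : F[X]) := hq'
    have hEv : (E : F[X]) = C (e : F) := rfl
    have hEi : ((E⁻¹ : F[X]ˣ) : F[X]) = C ((e⁻¹ : Fˣ) : F) := rfl
    have hdeg := degree_euclidStep_lt M hc
    rw [← (euclidStep_apply M).1] at hdeg
    set M' := euclidStep M
    have hM : M = upper (E : F[X]) * (weyl * M') := by
      rw [← hEc]; exact (upper_mul_weyl_mul_euclidStep M).symm
    have hM2 : weyl * M =
        upper (-(E⁻¹ : F[X]ˣ) : F[X]) *
          (weyl * (torus E * (upper (-(E⁻¹ : F[X]ˣ) : F[X]) * M'))) := by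
      rw [hM, ← mul_assoc, ← mul_assoc, weyl_mul_upper_mul_weyl]; simp only [mul_assoc]
    have hl : liftFun s u (weyl * (torus E * (upper (-(E⁻¹ : F[X]ˣ) : F[X]) * M'))) =
        s weyl * liftFun s u (torus E * (upper (-(E⁻¹ : F[X]ˣ) : F[X]) * M')) := by
      apply liftFun_weyl_mul_of_degree_lt
      rw [(torus_mul_apply _ _).2.2.1, (torus_mul_apply _ _).1, (upper_mul_apply _ _).2.2.1,
        (upper_mul_apply _ _).1, hEi, hE]
      have h1 : (-(C ((e⁻¹ : Fˣ) : F)) * M' 1 0).degree < (M' 0 0).degree := by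
        rwa [neg_mul, degree_neg, degree_C_mul (Units.ne_zero _)]
      rw [hEv, degree_C_mul (Units.ne_zero _), degree_C_mul (Units.ne_zero _),
        degree_add_eq_left_of_degree_lt h1]
      exact hdeg
    rw [hM2, liftFun_upper_mul hu, hl, liftFun_torus_mul hu ht, liftFun_upper_mul hu,
      liftFun_of_ne _ _ hc, hEc, hEi, ← C_neg, hu, hEv, hu]
    simp only [← mul_assoc, ← map_mul]
    rw [weyl_mul_upper_mul_weyl]
  · have hq : M 0 0 / M 1 0 = 0 := by
      rw [Polynomial.div_eq_zero_iff (fun h0 => by simp [h0] at h)]; exact h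
    have h1 : euclidStep M = torus (Units.map C.toMonoidHom (-1)) * (weyl * M) := by
      rw [euclidStep, hq, ← mul_assoc, neg_zero, upper_zero, mul_one, weyl_inv, mul_assoc]
      congr 2
      ext; simp
    rw [liftFun_of_ne _ _ (M := M) (fun h0 => by simp [h0] at h), hq, h1, liftFun_torus_mul hu ht]
    have h2 : s weyl * s weyl * s (torus (-1)) = 1 := by
      rw [← map_mul, ← map_mul, mul_assoc, ← inv_neg_one, ← torus_mul_weyl, ← weyl_inv,
        mul_inv_cancel, map_one]
    have h3 := congrArg (· * liftFun s u (weyl * M)) h2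
    simpa only [ofAdd_zero, map_one, one_mul, mul_assoc] using h3.symm

include hu ht in
theorem liftFun_map_C_mul (N : SL2 F) (M : SL2 F[X]) :
    liftFun s u (SpecialLinearGroup.map C N * M) = s N * liftFun s u M := by
  obtain ⟨e, x, rfl⟩ | ⟨e, x, y, rfl⟩ := bruhat N
  · rw [map_mul, map_upper, map_torus, mul_assoc, liftFun_upper_mul hu, hu, s.map_mul, mul_assoc]
    congr 1
    exact liftFun_torus_mul hu ht e M
  · have := liftFun_torus_mul hu ht e (upper (C y) * M)
    simp only [map_mul, map_upper, map_torus, map_weyl, mul_assoc, liftFun_upper_mul hu, hu,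
      liftFun_weyl_mul hu ht] at this ⊢
    rw [← this]
    rfl

/-- `SL₂(F[X])` is the amalgam of `SL₂(F)` and the upper triangular
matrices of `SL₂(F[X])`: homomorphisms defined on `SL₂(F)` and on the unipotent matrices
extend as soon as they agree on the unipotent matrices over `F` and respect conjugation by the
torus. -/
noncomputable def lift : SL2 F[X] →* G :=
  MonoidHom.mk' (liftFun s u) fun M N => by
    induction M using euclid_induction with
    | h0 M h =>
      conv_lhs => rw [eq_upper_mul_map M h]
      rw [mul_assoc, liftFun_upper_mul hu, liftFun_map_C_mul hu ht, ← mul_assoc,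
        ← liftFun_of_eq _ _ h]
    | h1 M h ih =>
      conv_lhs => rw [← upper_mul_weyl_mul_euclidStep M]
      rw [mul_assoc, mul_assoc, liftFun_upper_mul hu, liftFun_weyl_mul hu ht, ih,
        liftFun_of_ne _ _ h]
      simp only [mul_assoc]

theorem lift_upper (x : F[X]) : lift hu ht (upper x) = u (ofAdd x) := by
  have := liftFun_upper_mul hu x 1
  rwa [mul_one, liftFun_one, mul_one] at this

theorem lift_map_C (M : SL2 F) : lift hu ht (SpecialLinearGroup.map C M) = s M := by
  have := liftFun_map_C_mul hu ht M 1
  rwa [mul_one, liftFun_one, mul_one] at this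

end Lift
end Field

/-! ### The normal closure of the unipotent matrices -/

section NormalClosure

variable {F : Type*} [Field F]

theorem eq_top_of_upper_mem_field (N : Subgroup (SL2 F)) [hN : N.Normal] (h : ∀ x, upper x ∈ N) :
    N = ⊤ := by
  have hw : (weyl : SL2 F) ∈ N := by
    rw [weyl_eq]
    exact N.mul_mem (N.mul_mem (h _) (hN.conj_mem _ (h _) _)) (h _)
  have ht (e : Fˣ) : torus e ∈ N := by
    rw [torus_eq]
    exact N.mul_mem (N.mul_mem (N.mul_mem (h _) (hN.conj_mem _ (h _) _)) (h _)) hw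
  refine (Subgroup.eq_top_iff' N).2 fun M => ?_
  obtain ⟨e, x, rfl⟩ | ⟨e, x, y, rfl⟩ := bruhat M
  · exact N.mul_mem (h _) (ht _)
  · exact N.mul_mem (N.mul_mem (N.mul_mem (h _) hw) (ht _)) (h _)

theorem map_C_mem_of_upper_mem (N : Subgroup (SL2 F[X])) [N.Normal]
    (h : ∀ c : F, upper (C c) ∈ N) (M : SL2 F) : SpecialLinearGroup.map C M ∈ N := by
  have := eq_top_of_upper_mem_field (N.comap (SpecialLinearGroup.map C)) (by simpa using h)
  exact (Subgroup.eq_top_iff' _).1 this M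

theorem eq_top_of_upper_mem (N : Subgroup (SL2 F[X])) [N.Normal] (h : ∀ x, upper x ∈ N) :
    N = ⊤ := by
  have : QuotientGroup.mk' N = 1 := hom_ext
    (fun x => (QuotientGroup.eq_one_iff _).2 (h x))
    (fun M => (QuotientGroup.eq_one_iff _).2 (map_C_mem_of_upper_mem N (fun c => h _) M))
  rw [← QuotientGroup.ker_mk' N, this, MonoidHom.ker_one]

end NormalClosure

/-! ### Homomorphisms and automorphisms over fields with two or three elements -/

section SmallField

variable {F : Type*} [Field F] [Finite F]

theorem exists_ringEquiv_zmod (hq : Nat.card F ≤ 3) :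
    Nonempty (ZMod 2 ≃+* F) ∨ Nonempty (ZMod 3 ≃+* F) := by
  have := Fintype.ofFinite F
  have h1 : 1 < Nat.card F := Finite.one_lt_card
  obtain h | h : Nat.card F = 2 ∨ Nat.card F = 3 := by omega
  · exact Or.inl ⟨ZMod.ringEquivOfPrime F Nat.prime_two (by rw [← h, Nat.card_eq_fintype_card])⟩
  · exact Or.inr ⟨ZMod.ringEquivOfPrime F Nat.prime_three (by rw [← h, Nat.card_eq_fintype_card])⟩

theorem units_sq (hq : Nat.card F ≤ 3) (e : Fˣ) : e ^ 2 = 1 := by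
  have h1 : 1 < Nat.card F := Finite.one_lt_card
  have h2 : e ^ (Nat.card F - 1) = 1 := by rw [← Nat.card_units]; exact pow_card_eq_one'
  obtain h | h : Nat.card F - 1 = 1 ∨ Nat.card F - 1 = 2 := by omega
  · rw [h, pow_one] at h2; rw [h2, one_pow]
  · rwa [h] at h2

theorem exists_natCast_eq (hq : Nat.card F ≤ 3) (c : F) : ∃ n : ℕ, (n : F) = c := by
  obtain ⟨⟨e⟩⟩ | ⟨⟨e⟩⟩ := exists_ringEquiv_zmod hq <;>
  · refine ⟨(e.symm c).val, ?_⟩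
    rw [← map_natCast e, ZMod.natCast_zmod_val, e.apply_symm_apply]

/-- The sign character of `SL₂(𝔽₂) ≃ S₃`, by an explicit formula in the entries. -/
theorem exists_hom_zmod_two :
    ∃ s : SL2 (ZMod 2) →* Multiplicative (ZMod 2), ∀ x, s (upper x) = ofAdd x := by
  have key : ∀ a b c d a' b' c' d' : ZMod 2, a * d - b * c = 1 → a' * d' - b' * c' = 1 →
      (1 - (c * a' + d * c')) * (a * b' + b * d')
        + (c * a' + d * c') * ((a * a' + b * c') + (c * b' + d * d') + 1)
      = ((1 - c) * b + c * (a + d + 1)) + ((1 - c') * b' + c' * (a' + d' + 1)) := by decide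
  refine ⟨MonoidHom.mk' (fun M => ofAdd ((1 - M 1 0) * M 0 1 + M 1 0 * (M 0 0 + M 1 1 + 1)))
    fun M N => ?_, fun x => by simp⟩
  have hM := M.det_coe
  have hN := N.det_coe
  rw [det_fin_two] at hM hN
  rw [← ofAdd_add, ← key _ _ _ _ _ _ _ _ hM hN]
  simp [Matrix.mul_apply, Fin.sum_univ_two]

/-- The character of order `3` of `SL₂(𝔽₃)`, by an explicit formula in the entries. -/
theorem exists_hom_zmod_three :
    ∃ s : SL2 (ZMod 3) →* Multiplicative (ZMod 3), ∀ x, s (upper x) = ofAdd x := by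
  have key : ∀ a b c d : ZMod 3, a * d - b * c = 1 → ∀ a' b' c' d' : ZMod 3, a' * d' - b' * c' = 1 →
      (1 - (c * a' + d * c') ^ 2) * ((a * b' + b * d') * (c * b' + d * d'))
        + (c * a' + d * c') * ((a * a' + b * c') + (c * b' + d * d'))
      = ((1 - c ^ 2) * (b * d) + c * (a + d)) + ((1 - c' ^ 2) * (b' * d') + c' * (a' + d')) := by
    decide
  refine ⟨MonoidHom.mk' (fun M => ofAdd
      ((1 - M 1 0 ^ 2) * (M 0 1 * M 1 1) + M 1 0 * (M 0 0 + M 1 1)))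
    fun M N => ?_, fun x => by simp⟩
  have hM := M.det_coe
  have hN := N.det_coe
  rw [det_fin_two] at hM hN
  rw [← ofAdd_add, ← key _ _ _ _ hM _ _ _ _ hN]
  simp [Matrix.mul_apply, Fin.sum_univ_two]

theorem exists_hom_of_ringEquiv {K L : Type*} [Field K] [Field L] (e : K ≃+* L)
    (h : ∃ s : SL2 K →* Multiplicative K, ∀ x, s (upper x) = ofAdd x) :
    ∃ s : SL2 L →* Multiplicative L, ∀ x, s (upper x) = ofAdd x := by
  obtain ⟨s, hs⟩ := h
  refine ⟨((AddMonoidHom.toMultiplicative (e : K →+ L)).comp s).comp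
    (SpecialLinearGroup.map (e.symm : L →+* K)), fun x => ?_⟩
  rw [MonoidHom.comp_apply, map_upper, MonoidHom.comp_apply, hs]
  simp

theorem exists_hom (hq : Nat.card F ≤ 3) :
    ∃ s : SL2 F →* Multiplicative F, ∀ x, s (upper x) = ofAdd x := by
  obtain ⟨⟨e⟩⟩ | ⟨⟨e⟩⟩ := exists_ringEquiv_zmod hq
  · exact exists_hom_of_ringEquiv e exists_hom_zmod_two
  · exact exists_hom_of_ringEquiv e exists_hom_zmod_three

/-- The abelianization of `SL₂(F[X])` maps onto the additive group of `F[X]`. -/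
theorem exists_hom_polynomial (hq : Nat.card F ≤ 3) :
    ∃ Θ : SL2 F[X] →* Multiplicative F[X], ∀ x, Θ (upper x) = ofAdd x := by
  obtain ⟨s, hs⟩ := exists_hom hq
  refine ⟨lift (s := (AddMonoidHom.toMultiplicative (C : F →+* F[X]).toAddMonoidHom).comp s)
    (u := MonoidHom.id _) (fun x => ?_) (fun e x => ?_), fun x => lift_upper _ _ x⟩
  · rw [MonoidHom.comp_apply, hs]; rfl
  · rw [mul_comm, ← C_pow, ← Units.val_pow_eq_pow_val, units_sq hq]; simp

theorem exists_hom_of_addHom (hq : Nat.card F ≤ 3) (α : F[X] →+ F[X])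
    (hα : ∀ c, α (C c) = C c) : ∃ ψ : SL2 F[X] →* SL2 F[X], (∀ x, ψ (upper x) = upper (α x)) ∧
      ∀ M : SL2 F, ψ (SpecialLinearGroup.map C M) = SpecialLinearGroup.map C M := by
  have hu (x : F) : upperHom.comp (AddMonoidHom.toMultiplicative α) (ofAdd (C x)) =
      SpecialLinearGroup.map (C : F →+* F[X]) (upper x) := by
    rw [map_upper]
    exact congrArg upper (hα x)
  have ht (e : Fˣ) (x : F[X]) : SpecialLinearGroup.map C (torus e) *
      upperHom.comp (AddMonoidHom.toMultiplicative α) (ofAdd x) =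
      upperHom.comp (AddMonoidHom.toMultiplicative α) (ofAdd (C (e : F) ^ 2 * x)) *
      SpecialLinearGroup.map C (torus e) := by
    have he : C (e : F) ^ 2 = 1 := by
      rw [← C_pow, ← Units.val_pow_eq_pow_val, units_sq hq, Units.val_one, C_1]
    have he' : ((Units.map (C : F →+* F[X]).toMonoidHom e : F[X]ˣ) : F[X]) ^ 2 = 1 := he
    rw [he, one_mul, map_torus]
    refine (torus_mul_upper _ _).trans
      ((congrArg (fun y => upper (y * α x) * torus _) he').trans ?_)
    rw [one_mul]
    rfl
  exact ⟨lift hu ht, lift_upper hu ht, lift_map_C hu ht⟩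

/-- Any additive automorphism of `F[X]` that fixes the constants acts on the amalgam
`SL₂(F[X])`. -/
theorem exists_mulEquiv_of_addEquiv (hq : Nat.card F ≤ 3) (α : F[X] ≃+ F[X])
    (hα : ∀ c, α (C c) = C c) :
    ∃ ψ : SL2 F[X] ≃* SL2 F[X], ∀ x, ψ (upper x) = upper (α x) := by
  obtain ⟨f, hf, hf'⟩ := exists_hom_of_addHom hq (α : F[X] →+ F[X]) hα
  obtain ⟨g, hg, hg'⟩ := exists_hom_of_addHom hq (α.symm : F[X] →+ F[X])
    fun c => by simp [AddEquiv.symm_apply_eq, hα]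
  exact ⟨MonoidHom.toMulEquiv f g (hom_ext (by simp [hf, hg]) (by simp [hf', hg']))
    (hom_ext (by simp [hf, hg]) (by simp [hf', hg'])), hf⟩

end SmallField

/-! ### Unipotent matrices in a normal subgroup -/

section Cusp

variable {F : Type*} [Field F] [Finite F]

/-- The set of `x` such that `!![1, x; 0, 1] ∈ N`. It is a subspace because the
field is a prime field. -/
def upperSubmodule (hq : Nat.card F ≤ 3) (N : Subgroup (SL2 F[X])) : Submodule F F[X] where
  carrier := {x | upper x ∈ N}
  add_mem' hx hy := by
    rw [Set.mem_ofPred_eq, upper_add]; exact N.mul_mem hx hy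
  zero_mem' := by rw [Set.mem_ofPred_eq, upper_zero]; exact N.one_mem
  smul_mem' c x hx := by
    obtain ⟨n, rfl⟩ := exists_natCast_eq hq c
    have h : upper ((n : F) • x) = upper x ^ n := by
      rw [Nat.cast_smul_eq_nsmul, ← upperHom_ofAdd, ofAdd_nsmul, map_pow, upperHom_ofAdd]
    rw [Set.mem_ofPred_eq, h]
    exact N.pow_mem hx n

@[simp] theorem mem_upperSubmodule {hq : Nat.card F ≤ 3} {N : Subgroup (SL2 F[X])} {x : F[X]} :
    x ∈ upperSubmodule hq N ↔ upper x ∈ N := Iff.rfl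

theorem natCard_quotient_upperSubmodule (hq : Nat.card F ≤ 3) (N : Subgroup (SL2 F[X])) :
    Nat.card (F[X] ⧸ upperSubmodule hq N) = N.relIndex upperHom.range := by
  rw [← Subgroup.index_comap]
  exact AddSubgroup.index_toSubgroup (upperSubmodule hq N).toAddSubgroup

theorem natCard_quotient_upperSubmodule_dvd (hq : Nat.card F ≤ 3) (N : Subgroup (SL2 F[X]))
    [N.Normal] : Nat.card (F[X] ⧸ upperSubmodule hq N) ∣ N.index := by
  rw [natCard_quotient_upperSubmodule]
  exact Subgroup.relIndex_dvd_index_of_normal N _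

/-- When `N` contains the commutator subgroup, `N` together with the unipotent matrices generates a
normal subgroup, hence everything, so no index is lost by restricting to unipotent matrices. -/
theorem natCard_quotient_upperSubmodule_eq (hq : Nat.card F ≤ 3) (N : Subgroup (SL2 F[X]))
    [N.Normal] (h : commutator (SL2 F[X]) ≤ N) :
    Nat.card (F[X] ⧸ upperSubmodule hq N) = N.index := by
  have : (upperHom.range ⊔ N).Normal := Subgroup.Normal.of_commutator_le _ (h.trans le_sup_right)
  have htop : upperHom.range ⊔ N = ⊤ :=
    eq_top_of_upper_mem _ fun x => Subgroup.mem_sup_left ⟨ofAdd x, rfl⟩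
  rw [natCard_quotient_upperSubmodule, ← Subgroup.relIndex_sup_right, htop,
    Subgroup.relIndex_top_right]

theorem natCard_quotient_upperSubmodule_eq_pow (hq : Nat.card F ≤ 3) (N : Subgroup (SL2 F[X]))
    [N.Normal] [hN : N.FiniteIndex] :
    Finite (F[X] ⧸ upperSubmodule hq N) ∧ Nat.card (F[X] ⧸ upperSubmodule hq N) =
      Nat.card F ^ Module.finrank F (F[X] ⧸ upperSubmodule hq N) := by
  have : Finite (F[X] ⧸ upperSubmodule hq N) := Nat.finite_of_card_ne_zero
    (ne_zero_of_dvd_ne_zero hN.index_ne_zero (natCard_quotient_upperSubmodule_dvd hq N))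
  exact ⟨this, Module.natCard_eq_pow_finrank⟩

theorem isCongruence_top {A : Type*} [CommRing A] [Nontrivial A] :
    IsCongruence (⊤ : Subgroup (SL2 A)) :=
  ⟨⊤, top_ne_bot, le_top⟩

theorem finrank_quotient_upperSubmodule_ne_zero (hq : Nat.card F ≤ 3) (N : Subgroup (SL2 F[X]))
    [N.Normal] (hN : IsNonCongruence N) :
    Module.finrank F (F[X] ⧸ upperSubmodule hq N) ≠ 0 := by
  intro h
  have := hN.1
  obtain ⟨_, -⟩ := natCard_quotient_upperSubmodule_eq_pow hq N
  have hs := Module.finrank_zero_iff.1 h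
  rw [Submodule.Quotient.subsingleton_iff] at hs
  refine hN.2 ?_
  rw [eq_top_of_upper_mem N fun x => mem_upperSubmodule.1 (hs ▸ Submodule.mem_top)]
  exact isCongruence_top

end Cusp

/-! ### Congruence subgroups containing the commutator subgroup -/

section Commutator

variable {F : Type*} [Field F]

theorem upper_mul_mem_of_mem {N : Subgroup (SL2 F[X])} {I : Ideal F[X]} (hI : principal I ≤ N)
    {f : F[X]} (hf : f ∈ I) : upper f ∈ N := by
  refine hI ((mem_principal I _).2 fun i j => ?_)
  fin_cases i <;> fin_cases j <;> simp [hf]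

/-- A matrix congruent to `diag(v, v⁻¹)` modulo `f` conjugates `upper x` to `upper (v² x)` up to an
element of `Γ(I)`. -/
theorem upper_sq_sub_one_mul_mem {N : Subgroup (SL2 F[X])} (hc : commutator (SL2 F[X]) ≤ N)
    {I : Ideal F[X]} (hI : principal I ≤ N) {f : F[X]} (hf : f ∈ I) {v : F[X]}
    (hv : IsCoprime v f) (x : F[X]) : upper ((v ^ 2 - 1) * x) ∈ N := by
  obtain ⟨a, b, hab⟩ := hv.pow_right (n := 2)
  obtain ⟨M, hM⟩ : ∃ M : SL2 F[X],
      (M : Matrix (Fin 2) (Fin 2) F[X]) = !![v, -f; f * b, a] :=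
    ⟨⟨!![v, -f; f * b, a], by rw [det_fin_two_of]; linear_combination hab⟩, rfl⟩
  have h1 : M * upper x * M⁻¹ * upper (-(v ^ 2 * x)) ∈ N := by
    refine hI ((mem_principal I _).2 fun i j => Ideal.mem_of_dvd I ?_ hf)
    have hm : (↑(M * upper x * M⁻¹ * upper (-(v ^ 2 * x))) : Matrix (Fin 2) (Fin 2) F[X]) =
        !![1 - v * (f * b) * x, v ^ 2 * x - v ^ 2 * x * (1 - v * (f * b) * x);
          -(f * b) ^ 2 * x, 1 + v * (f * b) * x + (f * b) ^ 2 * x * (v ^ 2 * x)] := by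
      simp only [Matrix.SpecialLinearGroup.coe_mul, Matrix.SpecialLinearGroup.coe_inv, hM,
        coe_upper, adjugate_fin_two_of, mul_fin_two]
      refine Matrix.ext fun i j => ?_
      fin_cases i <;> fin_cases j <;> dsimp
      · linear_combination hab
      · linear_combination (-(v ^ 2 * x)) * hab
      · ring
      · linear_combination hab
    rw [hm]
    fin_cases i <;> fin_cases j
    · exact ⟨-(v * b * x), by simp; ring⟩
    · exact ⟨v ^ 2 * x * (v * b * x), by simp; ring⟩
    · exact ⟨-(f * b ^ 2 * x), by simp; ring⟩
    · exact ⟨v * b * x + f * b ^ 2 * x * (v ^ 2 * x), by simp; ring⟩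
  have h2 : M * upper x * M⁻¹ * (upper x)⁻¹ ∈ N :=
    hc (Subgroup.commutator_mem_commutator (Subgroup.mem_top _) (Subgroup.mem_top _))
  have h3 : upper ((v ^ 2 - 1) * x) =
      (M * upper x * M⁻¹ * upper (-(v ^ 2 * x)))⁻¹ *
        (M * upper x * M⁻¹ * (upper x)⁻¹) := by
    rw [sub_mul, one_mul, sub_eq_add_neg, upper_add, upper_neg, upper_neg]
    group
  rw [h3]
  exact N.mul_mem (N.inv_mem h1) h2

/-- The ideal is the same for all congruence subgroups with abelian quotient. If
`f = Xⁿ g` lies in the level, choose `v ≡ X + 1` modulo `Xⁿ` and `v ≡ X` modulo `g`; the ideal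
generated by `f` and `v² - 1` then contains `((X + 1)² - 1) (X² - 1)`. -/
theorem upper_mem_of_isCongruence {N : Subgroup (SL2 F[X])} (hc : commutator (SL2 F[X]) ≤ N)
    (hN : IsCongruence N) (x : F[X]) : upper ((X ^ 2 - 1) * (X ^ 2 + 2 * X) * x) ∈ N := by
  obtain ⟨I, hI0, hI⟩ := hN
  obtain ⟨f, hf, hf0⟩ := Submodule.exists_mem_ne_zero_of_ne_bot hI0
  obtain ⟨g, hg, hXg⟩ := Polynomial.exists_eq_pow_rootMultiplicity_mul_and_not_dvd f hf0 0
  rw [C_0, sub_zero] at hg hXg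
  set n := rootMultiplicity 0 f
  -- The exponent `n + 1` instead of `n` makes `X` divide the modulus even if `X ∤ f`.
  have hcop : IsCoprime (X ^ (n + 1)) g :=
    IsCoprime.pow_left ((irreducible_X.coprime_iff_not_dvd).2 hXg)
  obtain ⟨p, r, hpr⟩ := hcop
  -- By the Bézout relation, `X + r g` is `X + 1` modulo `X ^ (n + 1)` and `X` modulo `g`.
  have hv : IsCoprime (X + r * g) (X ^ (n + 1) * g) := by
    refine IsCoprime.mul_right (IsCoprime.pow_right ⟨1, p * X ^ n - 1, ?_⟩)
      ⟨p * X ^ n, r - p * X ^ n * r, ?_⟩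
    · linear_combination hpr
    · linear_combination hpr
  have hfX : X ^ (n + 1) * g ∈ I := by
    have := I.mul_mem_left X hf
    rwa [hg, ← mul_assoc, ← pow_succ'] at this
  have h1 := upper_sq_sub_one_mul_mem hc hI hfX hv
    ((X ^ 2 + 2 * X - r * g * (2 * X + r * g)) * x)
  have h2 := upper_mul_mem_of_mem hI (I.mul_mem_right
    (r * p * (2 * X + r * g) * (p * X ^ (n + 1) - 2 * (X + 1)) * x) hfX)
  have h3 := N.mul_mem h1 h2
  rw [← upper_add] at h3
  convert h3 using 2
  linear_combination (r * g * (2 * X + r * g) * (2 * X + r * g - p * X ^ (n + 1) + 1) * x) * hpr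

end Commutator

/-! ### Existence of non-congruence subgroups -/

section Examples

variable {F : Type*} [Field F] [Finite F]

/-- The kernel of `L` composed with the homomorphism `SL₂(F[X]) → F[X]`. -/
theorem exists_normal_of_linearMap (hq : Nat.card F ≤ 3) {V : Type*} [AddCommGroup V] [Module F V]
    (L : F[X] →ₗ[F] V) (hL : Function.Surjective L) :
    ∃ N : Subgroup (SL2 F[X]), N.Normal ∧ commutator (SL2 F[X]) ≤ N ∧ N.index = Nat.card V ∧
      ∀ x, upper x ∈ N ↔ L x = 0 := by
  obtain ⟨Θ, hΘ⟩ := exists_hom_polynomial hq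
  let θ : SL2 F[X] →* Multiplicative V := (AddMonoidHom.toMultiplicative (L : F[X] →+ V)).comp Θ
  have hθ (x : F[X]) : θ (upper x) = ofAdd (L x) := by
    simp only [θ, MonoidHom.comp_apply, hΘ]; rfl
  refine ⟨θ.ker, inferInstance, Abelianization.commutator_subset_ker θ, ?_, fun x => ?_⟩
  · have hs : Function.Surjective θ := fun v => by
      obtain ⟨x, hx⟩ := hL v.toAdd
      exact ⟨upper x, by rw [hθ, hx]; rfl⟩
    rw [Subgroup.index_ker, MonoidHom.range_eq_top.2 hs, Subgroup.card_top]
    rfl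
  · rw [MonoidHom.mem_ker, hθ, ofAdd_eq_one]

theorem index_le_of_isCongruence (hq : Nat.card F ≤ 3) {N : Subgroup (SL2 F[X])}
    (hc : commutator (SL2 F[X]) ≤ N) (hN : IsCongruence N) : N.index ≤ Nat.card F ^ 4 := by
  have hn : N.Normal := Subgroup.Normal.of_commutator_le _ hc
  set h : F[X] := (X ^ 2 - 1) * (X ^ 2 + 2 * X) with hh
  have hdeg : h.natDegree = 4 := by rw [hh]; compute_degree!
  have hfr : Module.finrank F (F[X] ⧸ Ideal.span {h}) = 4 := by
    rw [finrank_quotient_span_eq_natDegree, hdeg]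
  have hfin : Module.Finite F (F[X] ⧸ Ideal.span {h}) :=
    Module.finite_of_finrank_pos (by rw [hfr]; norm_num)
  have hfin' : Finite (F[X] ⧸ Ideal.span {h}) := Module.finite_of_finite F
  rw [← natCard_quotient_upperSubmodule_eq hq N hc, ← hfr, ← Module.natCard_eq_pow_finrank]
  have hle : (Ideal.span {h}).restrictScalars F ≤ upperSubmodule hq N := by
    intro y hy
    obtain ⟨x, rfl⟩ := Ideal.mem_span_singleton.1 hy
    exact upper_mem_of_isCongruence hc hN x
  exact Nat.card_le_card_of_surjective _ (Submodule.factor_surjective hle)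

theorem exists_isNonCongruence (hq : Nat.card F ≤ 3) :
    ∃ N : Subgroup (SL2 F[X]), N.Normal ∧ IsNonCongruence N ∧ N.index = Nat.card F := by
  obtain ⟨N, hn, hc, hi, hN⟩ := exists_normal_of_linearMap hq (lcoeff F 4)
    fun c => ⟨monomial 4 c, by simp⟩
  refine ⟨N, hn, ⟨⟨by rw [hi]; exact Nat.card_pos.ne'⟩, fun h => ?_⟩, hi⟩
  have h1 := (hN _).1 (upper_mem_of_isCongruence hc h 1)
  have h2 : ((X ^ 2 - 1) * (X ^ 2 + 2 * X) * 1 : F[X]) = X ^ 4 + C 2 * X ^ 3 - X ^ 2 - C 2 * X := by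
    rw [C_ofNat]; ring
  rw [h2] at h1
  simp [coeff_X_pow] at h1

/-- An elementary abelian quotient of order `q⁵` exceeds the bound `q⁴` for congruence subgroups, and
automorphisms do not change the quotient. -/
theorem exists_isGenuineNonCongruence (hq : Nat.card F ≤ 3) :
    ∃ N : Subgroup (SL2 F[X]), N.Normal ∧ IsGenuineNonCongruence N := by
  obtain ⟨N, hn, hc, hi, -⟩ := exists_normal_of_linearMap hq
    (LinearMap.pi fun i : Fin 5 => lcoeff F i) fun c =>
      ⟨∑ i : Fin 5, monomial i (c i), by
        ext j; simp [coeff_monomial, Fin.val_inj]⟩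
  have h1 : 1 < Nat.card F := Finite.one_lt_card
  have hi5 : N.index = Nat.card F ^ 5 := by
    rw [hi, Nat.card_fun, Nat.card_fin]
  have hf : N.FiniteIndex := ⟨by rw [hi5]; positivity⟩
  refine ⟨N, hn, hf, fun Ψ => ?_⟩
  have hi' : (N.map Ψ.toMonoidHom).index = N.index := Subgroup.index_map_equiv N Ψ
  refine ⟨⟨by rw [hi']; exact hf.index_ne_zero⟩, fun h => ?_⟩
  have hc' : commutator (SL2 F[X]) ≤ N.map Ψ.toMonoidHom := by
    have : commutator (SL2 F[X]) = (commutator (SL2 F[X])).map Ψ.toMonoidHom := by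
      rw [commutator_def, Subgroup.map_commutator, ← MonoidHom.range_eq_map,
        MonoidHom.range_eq_top.2 Ψ.surjective]
    rw [this]
    exact Subgroup.map_mono hc
  have := index_le_of_isCongruence hq hc' h
  rw [hi', hi5] at this
  exact absurd ((Nat.pow_le_pow_iff_right h1).1 this) (by norm_num)

end Examples

/-! ### Normal subgroups of small index -/

section Divisibility

variable {F : Type*} [Field F]

/-- Modulo `N`, the identity agrees on generators with evaluation at `0`, so `N` contains the
kernel `Γ(X)` of that evaluation. -/
theorem isCongruence_of_eval_zero {N : Subgroup (SL2 F[X])} [N.Normal]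
    (h : ∀ x : F[X], x.eval 0 = 0 → upper x ∈ N) : IsCongruence N := by
  refine ⟨Ideal.span {X}, by simp, fun M hM => ?_⟩
  have key : QuotientGroup.mk' N = ((QuotientGroup.mk' N).comp (SpecialLinearGroup.map C)).comp
      (SpecialLinearGroup.map (evalRingHom 0)) := by
    refine hom_ext (fun x => ?_) fun M => ?_
    · simp only [MonoidHom.comp_apply, map_upper]
      rw [eq_comm, QuotientGroup.mk'_eq_mk']
      refine ⟨upper (x - C (x.eval 0)), h _ (by simp), ?_⟩
      rw [coe_evalRingHom, ← upper_add, add_sub_cancel]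
    · simp only [MonoidHom.comp_apply]
      congr 2
      ext i j; simp
  have hM0 : SpecialLinearGroup.map (evalRingHom 0) M = 1 := by
    ext i j
    have := (mem_principal _ M).1 hM i j
    rw [Ideal.mem_span_singleton, X_dvd_iff, coeff_zero_eq_eval_zero, eval_sub, sub_eq_zero] at this
    rw [Matrix.SpecialLinearGroup.map_apply_coe, RingHom.mapMatrix_apply, map_apply,
      coe_evalRingHom, this]
    fin_cases i <;> fin_cases j <;> simp
  have := DFunLike.congr_fun key M
  rw [MonoidHom.comp_apply, hM0, map_one] at this
  exact (QuotientGroup.eq_one_iff M).1 this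

variable [Finite F]

/-- Modulo `N`, constant matrices are trivial, and the identity factors through the difference
of the characters of `SL₂(F)` at the points `1` and `0`. That difference is trivial on `Γ(X (X - 1))`. -/
theorem isCongruence_of_eval_zero_eq_eval_one (hq : Nat.card F ≤ 3) {N : Subgroup (SL2 F[X])}
    [N.Normal] (h : ∀ x : F[X], x.eval 1 = x.eval 0 → upper x ∈ N) : IsCongruence N := by
  obtain ⟨s, hs⟩ := exists_hom hq
  refine ⟨Ideal.span {X * (X - C 1)}, ?_, fun M hM => ?_⟩
  · simp [X_sub_C_ne_zero (1 : F), -map_one]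
  let κ : SL2 F[X] →* Multiplicative F :=
    s.comp (SpecialLinearGroup.map (evalRingHom 1)) /
      s.comp (SpecialLinearGroup.map (evalRingHom 0))
  have hκ (M : SL2 F[X]) : κ M = s (SpecialLinearGroup.map (evalRingHom 1) M) /
      s (SpecialLinearGroup.map (evalRingHom 0) M) := rfl
  let ι : Multiplicative F →* SL2 F[X] := upperHom.comp
    (AddMonoidHom.toMultiplicative
      ((LinearMap.toSpanSingleton F F[X] X : F →ₗ[F] F[X]) : F →+ F[X]))
  have hι (c : F) : ι (ofAdd c) = upper (c • X) := rfl
  have key : QuotientGroup.mk' N = ((QuotientGroup.mk' N).comp ι).comp κ := by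
    refine hom_ext (fun x => ?_) fun M => ?_
    · rw [MonoidHom.comp_apply, MonoidHom.comp_apply, hκ, map_upper, map_upper, hs, hs, ← ofAdd_sub,
        hι, eq_comm, QuotientGroup.mk'_eq_mk']
      refine ⟨upper (x - (evalRingHom 1 x - evalRingHom 0 x) • X), h _ (by simp), ?_⟩
      rw [← upper_add, add_sub_cancel]
    · have h1 : κ (SpecialLinearGroup.map C M) = 1 := by
        rw [hκ, div_eq_one]
        congr 1
        ext i j; simp
      rw [MonoidHom.comp_apply, h1, map_one]
      exact (QuotientGroup.eq_one_iff _).2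
        (map_C_mem_of_upper_mem N (fun c => h _ (by simp)) M)
  have hM0 (c : F) (hc : c = 0 ∨ c = 1) : SpecialLinearGroup.map (evalRingHom c) M = 1 := by
    ext i j
    obtain ⟨y, hy⟩ := Ideal.mem_span_singleton.1 ((mem_principal _ M).1 hM i j)
    have := congrArg (eval c) hy
    have hz : eval c (X * (X - C 1) * y) = 0 := by
      rcases hc with rfl | rfl <;> simp
    rw [hz, eval_sub, sub_eq_zero] at this
    rw [Matrix.SpecialLinearGroup.map_apply_coe, RingHom.mapMatrix_apply, map_apply,
      coe_evalRingHom, this]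
    fin_cases i <;> fin_cases j <;> simp
  have := DFunLike.congr_fun key M
  rw [MonoidHom.comp_apply, hκ, hM0 0 (.inl rfl), hM0 1 (.inr rfl), div_self', map_one] at this
  exact (QuotientGroup.eq_one_iff M).1 this

/-- The automorphism comes from the transvection `x ↦ x + (φ - φ₀)(x) v`, which fixes the constants
and carries `φ` to `φ₀`. -/
theorem exists_mulEquiv_of_linearMap (hq : Nat.card F ≤ 3) (φ φ₀ : F[X] →ₗ[F] F) {v : F[X]}
    (hv : φ v = 1) (hv₀ : φ₀ v = 1) (h1 : φ 1 = φ₀ 1) {N : Subgroup (SL2 F[X])}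
    (hN : ∀ x, φ x = 0 → upper x ∈ N) :
    ∃ Ψ : SL2 F[X] ≃* SL2 F[X], ∀ x, φ₀ x = 0 → upper x ∈ N.map Ψ.toMonoidHom := by
  have hf : (φ - φ₀) v = 0 := by simp [hv, hv₀]
  let α := LinearEquiv.transvection hf
  have hα (x : F[X]) : α x = x + (φ - φ₀) x • v := rfl
  have hC (c : F) : α (C c) = C c := by
    have : (C c : F[X]) = c • 1 := by rw [smul_eq_C_mul, mul_one]
    rw [hα, this, map_smul, LinearMap.sub_apply, h1, sub_self, smul_zero, zero_smul, add_zero]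
  obtain ⟨Ψ, hΨ⟩ := exists_mulEquiv_of_addEquiv hq α.toAddEquiv hC
  refine ⟨Ψ, fun y hy => ⟨upper (α.symm y), hN _ ?_, ?_⟩⟩
  · obtain ⟨x, rfl⟩ := α.surjective y
    rw [LinearEquiv.symm_apply_apply]
    rw [hα, map_add, map_smul, hv₀] at hy
    simpa using hy
  · exact (hΨ _).trans (congrArg upper (α.apply_symm_apply y))

/-- Otherwise the unipotent matrices in `N` form a hyperplane `ker φ` of `F[X]`. An automorphism moves
it to the zeros of evaluation at `0` if `φ 1 ≠ 0`, and of the difference of the evaluations at `1` and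
`0` if `φ 1 = 0`; in both cases the image of `N` is a congruence subgroup. -/
theorem sq_dvd_index (hq : Nat.card F ≤ 3) (N : Subgroup (SL2 F[X])) [N.Normal]
    (hN : IsGenuineNonCongruence N) : Nat.card F ^ 2 ∣ N.index := by
  have hfi := hN.1
  obtain ⟨hfin, hcard⟩ := natCard_quotient_upperSubmodule_eq_pow hq N
  have hdvd := natCard_quotient_upperSubmodule_dvd hq N
  have hnc : IsNonCongruence N := by
    have := hN.2 (MulEquiv.refl _)
    rwa [show (MulEquiv.refl (SL2 F[X])).toMonoidHom = MonoidHom.id _ from rfl,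
      Subgroup.map_id] at this
  have h0 := finrank_quotient_upperSubmodule_ne_zero hq N hnc
  set H := upperSubmodule hq N with hH
  by_contra hnd
  have hd1 : Module.finrank F (F[X] ⧸ H) = 1 := by
    by_contra h1
    exact hnd ((pow_dvd_pow _ (by omega)).trans (hcard ▸ hdvd))
  have hnorm (Ψ : SL2 F[X] ≃* SL2 F[X]) : (N.map Ψ.toMonoidHom).Normal :=
    Subgroup.Normal.map ‹_› _ Ψ.surjective
  let e : (F[X] ⧸ H) ≃ₗ[F] F := LinearEquiv.ofFinrankEq _ _ (by rw [hd1, Module.finrank_self])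
  let φ : F[X] →ₗ[F] F := e.toLinearMap.comp H.mkQ
  have hφ (x : F[X]) : φ x = 0 → upper x ∈ N := fun hx => by
    have : H.mkQ x = 0 := e.map_eq_zero_iff.1 hx
    exact (Submodule.Quotient.mk_eq_zero H).1 this
  obtain ⟨w, hw⟩ : ∃ w, φ w = 1 := (e.surjective.comp H.mkQ_surjective) 1
  by_cases h1 : φ 1 = 0
  -- A vector space is not the union of two hyperplanes; `w` and `X` witness this here.
  · obtain ⟨v, hv, hv₀⟩ : ∃ v, φ v ≠ 0 ∧ (leval 1 - leval 0 : F[X] →ₗ[F] F) v ≠ 0 := by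
      by_cases hX : φ X = 0
      · by_cases hw0 : (leval 1 - leval 0 : F[X] →ₗ[F] F) w = 0
        · refine ⟨w + X, by simp [hw, hX], ?_⟩
          rw [map_add, hw0]; simp
        · exact ⟨w, by simp [hw], hw0⟩
      · exact ⟨X, hX, by simp⟩
    obtain ⟨Ψ, hΨ⟩ := exists_mulEquiv_of_linearMap hq ((φ v)⁻¹ • φ)
      (((leval 1 - leval 0 : F[X] →ₗ[F] F) v)⁻¹ • (leval 1 - leval 0)) (v := v) (N := N)
      (inv_mul_cancel₀ hv) (inv_mul_cancel₀ hv₀) (by simp [h1])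
      fun x hx => hφ x ((mul_eq_zero.1 hx).resolve_left (inv_ne_zero hv))
    have := hnorm Ψ
    exact (hN.2 Ψ).2 (isCongruence_of_eval_zero_eq_eval_one hq fun x hx => hΨ x (by simp [hx]))
  · obtain ⟨Ψ, hΨ⟩ := exists_mulEquiv_of_linearMap hq ((φ 1)⁻¹ • φ) (leval 0) (v := 1) (N := N)
      (inv_mul_cancel₀ h1) (by simp) (by simp [h1])
      fun x hx => hφ x ((mul_eq_zero.1 hx).resolve_left (inv_ne_zero h1))
    have := hnorm Ψ
    exact (hN.2 Ψ).2 (isCongruence_of_eval_zero fun x hx => hΨ x (by simp [hx]))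

theorem card_le_index (hq : Nat.card F ≤ 3) (N : Subgroup (SL2 F[X])) [N.Normal]
    (hN : IsNonCongruence N) : Nat.card F ≤ N.index := by
  have hfi := hN.1
  obtain ⟨-, hcard⟩ := natCard_quotient_upperSubmodule_eq_pow hq N
  have h0 := finrank_quotient_upperSubmodule_ne_zero hq N hN
  exact Nat.le_of_dvd (Nat.pos_of_ne_zero hfi.index_ne_zero) ((dvd_pow_self _ h0).trans
    (hcard ▸ natCard_quotient_upperSubmodule_dvd hq N))

end Divisibility

end SL2Congruence

theorem theorem6p3 {F : Type*} [Field F] [Finite F] (hq : Nat.card F ≤ 3) :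
    (∀ N : Subgroup (SL2Congruence.SL2 F[X]), N.Normal →
      SL2Congruence.IsGenuineNonCongruence N → Nat.card F ^ 2 ∣ N.index) ∧
    (SL2Congruence.normalNonCongruenceIndices F[X]).Nonempty ∧
    (SL2Congruence.normalGenuineNonCongruenceIndices F[X]).Nonempty ∧
    SL2Congruence.nncs F[X] = Nat.card F ∧
    SL2Congruence.nncs F[X] < SL2Congruence.ngncs F[X] := by
  have hdvd : ∀ N : Subgroup (SL2Congruence.SL2 F[X]), N.Normal →
      SL2Congruence.IsGenuineNonCongruence N → Nat.card F ^ 2 ∣ N.index :=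
    fun N _ hN => SL2Congruence.sq_dvd_index hq N hN
  obtain ⟨N, hn, hN, hi⟩ := SL2Congruence.exists_isNonCongruence hq
  obtain ⟨N', hn', hN'⟩ := SL2Congruence.exists_isGenuineNonCongruence hq
  have hne : (SL2Congruence.normalNonCongruenceIndices F[X]).Nonempty := ⟨_, N, hn, hN, rfl⟩
  have hne' : (SL2Congruence.normalGenuineNonCongruenceIndices F[X]).Nonempty :=
    ⟨_, N', hn', hN', rfl⟩
  have hnncs : SL2Congruence.nncs F[X] = Nat.card F := by
    refine le_antisymm (Nat.sInf_le ⟨N, hn, hN, hi⟩) ?_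
    obtain ⟨M, hMn, hM, hMi⟩ := Nat.sInf_mem hne
    rw [SL2Congruence.nncs, ← hMi]
    exact SL2Congruence.card_le_index hq M hM
  refine ⟨hdvd, hne, hne', hnncs, ?_⟩
  obtain ⟨M, hMn, hM, hMi⟩ := Nat.sInf_mem hne'
  rw [hnncs, SL2Congruence.ngncs, ← hMi]
  have h1 : 1 < Nat.card F := Finite.one_lt_card
  calc Nat.card F < Nat.card F ^ 2 := lt_self_pow₀ h1 (by norm_num)
    _ ≤ M.index := Nat.le_of_dvd (Nat.pos_of_ne_zero hM.1.index_ne_zero) (hdvd M hMn hM)
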